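/- **Setting.** Let $D$ be a probability distribution of triples $(X,A,Y)\in\mathcal X\times\mathcal A\times\{0,1\}$, where $\mathcal X,\mathcal A$ are measurable spaces, and let $\mathcal H$ be a family of measurable classifiers $h:\mathcal X\to\{0,1\}$ that is pointwise separable: it has a countable subfamily such that every $h\in\mathcal H$ is the pointwise limit of a sequence in the subfamily. Let $\Delta$ be the set of (discrete) probability distributions on $\mathcal H$. Any functional $\varphi$ of classifiers is extended to $Q\in\Delta$ by $\varphi(Q)=\sum_{h\in\mathcal H}Q(h)\varphi(h)$. Let $\mathcal J,\mathcal K$ be finite index sets, $M\in\mathbb R^{\mathcal K\times\mathcal J}$, $c\in\mathbb R^{\mathcal K}$, and for $j\in\mathcal J$ let $g_j:\mathcal X\times\mathcal A\times\{0,1\}\times\{0,1\}\to[0,1]$ be measurable and $\mathcal E_j\subseteq\mathcal X\times\mathcal A\times\{0,1\}$ be a measurable event. Put $$\mathrm{err}(h)=\mathbb P_D[h(X)\ne Y],\qquad \mu_j(h)=\mathbb E_D[g_j(X,A,Y,h(X))\mid\mathcal E_j],\qquad \gamma_k(Q)=\sum_{j}M_{kj}\,\mu_j(Q)$$ (a conditional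 expectation given a null event is read as $0$). Let $(X_i,A_i,Y_i)_{i=1}^n$, $n\ge1$, be i.i.d. draws from $D$, let $n_j=|\{i:(X_i,A_i,Y_i)\in\mathcal E_j\}|$, let $\widehat{\mathrm{err}}(h)$ be the fraction of the $n$ examples with $h(X_i)\neq Y_i$, let $\widehat\mu_j(h)$ be the average of $g_j(X_i,A_i,Y_i,h(X_i))$ over the $n_j$ examples in $\mathcal E_j$, and let $\widehat\gamma_k(Q)=\sum_jM_{kj}\,\widehat\mu_j(Q)$. The (worst-case) Rademacher complexity is $$R_m(\mathcal H)=\sup_{x_1,\dots,x_m\in\mathcal X}\mathbb E_\sigma\Big[\sup_{h\in\mathcal H}\Big|\frac1m\sum_{i=1}^m\sigma_ih(x_i)\Big|\Big],$$ with $\sigma_1,\dots,\sigma_m$ independent and uniform on $\{-1,1\}$. For $B>0$ let $\Lambda=\{\lambda\in\mathbb R^{\mathcal K}:\lambda\ge0,\ \|\lambda\|_1\le B\}$. For $\varepsilon\in\mathbb R^{\mathcal K}$ put $\widehat c=c+\varepsilon$ and $L(Q,\lambda)=\widehat{\mathrm{err}}(Q)+\sum_k\lambda_k(\widehat\gamma_k(Q)-\widehat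 c_k)$. A pair $(\widehat Q,\widehat\lambda)\in\Delta\times\Lambda$ is a $\nu$-approximate saddle point of $L$ if $L(\widehat Q,\widehat\lambda)\le L(Q,\widehat\lambda)+\nu$ for all $Q\in\Delta$ and $L(\widehat Q,\widehat\lambda)\ge L(\widehat Q,\lambda)-\nu$ for all $\lambda\in\Lambda$. **Theorem.** Let $\delta>0$, $\nu\in\mathbb R$, $B>0$, and let $Q^\star\in\Delta$ minimize $\mathrm{err}(Q)$ over all $Q\in\Delta$ with $\gamma_k(Q)\le c_k$ for all $k$. Then with probability at least $1-(|\mathcal J|+1)\delta$ over the sample, the following holds for every $\varepsilon\in\mathbb R^{\mathcal K}$ (which may depend on the sample) with $$\varepsilon_k\ \ge\ \sum_{j\in\mathcal J}|M_{kj}|\Big(2R_{n_j}(\mathcal H)+\frac2{\sqrt{n_j}}+\sqrt{\frac{\ln(2/\delta)}{2n_j}}\Big)\qquad\text{for all }k$$ (the bracket being $+\infty$ when $n_j=0$, and $0\cdot\infty=0$) and for every $\nu$-approximate saddle point $(\widehat Q,\widehat\lambda)$ of $L$ with $\widehat c=c+\varepsilon$: $$\mathrm{err}(\widehat Q)\ \le\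 \mathrm{err}(Q^\star)+2\nu+4R_n(\mathcal H)+\frac4{\sqrt n}+\sqrt{\frac{2\ln(2/\delta)}{n}},$$ $$\gamma_k(\widehat Q)\ \le\ c_k+\frac{1+2\nu}{B}+2\varepsilon_k\qquad\text{for all }k\in\mathcal K.$$ -/

import Mathlib

open MeasureTheory

namespace FairClassification

/-- A labelled example `(x, a, y)`: features, protected attribute, binary label. -/
abbrev Ex (X A : Type*) := X × A × Bool

section Rademacher

/-- Worst-case Rademacher complexity of a class `F` of real functions: the supremum over all
`z₁, …, zₙ` of the average over the `2 ^ n` sign vectors `σ` of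
`sup_{f ∈ F} |(1 / n) ∑ i, σ i * f (z i)|`. -/
noncomputable def rademacher {Z : Type*} (F : Set (Z → ℝ)) (n : ℕ) : ℝ :=
  ⨆ z : Fin n → Z, (∑ σ : Fin n → ℤˣ,
    ⨆ f : F, |(1 / (n : ℝ)) * ∑ i, (((σ i : ℤˣ) : ℤ) : ℝ) * (f : Z → ℝ) (z i)|) / 2 ^ n

/-- A family of classifiers, read as a class of functions with values in `{0, 1} ⊆ ℝ`. -/
def realClass {X : Type*} (H : Set (X → Bool)) : Set (X → ℝ) :=
  (fun h x => if h x then 1 else 0) '' H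

/-- `2 R_m(H) + 2 / √m + √(ln (2 / δ) / (2 m))`, used only for `m > 0`. -/
noncomputable def radius {X : Type*} (H : Set (X → Bool)) (δ : ℝ) (m : ℕ) : ℝ :=
  2 * rademacher (realClass H) m + 2 / √(m : ℝ) + √(Real.log (2 / δ) / (2 * (m : ℝ)))

end Rademacher

/-- The family `H` contains a countable subfamily such that every member of `H` is the pointwise
limit of a sequence of members of the subfamily. -/
def PointwiseSeparable {X : Type*} (H : Set (X → Bool)) : Prop :=
  ∃ H₀ ⊆ H, H₀.Countable ∧ ∀ h ∈ H, ∃ u : ℕ → X → Bool,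
    (∀ m, u m ∈ H₀) ∧ ∀ x, ∀ᶠ m in Filter.atTop, u m x = h x

/-- `φ(Q) = ∑ h, Q(h) φ(h)`: a functional of classifiers, extended to a randomized classifier `Q`,
that is, to a discrete probability distribution over `H`. -/
noncomputable def mix {X : Type*} {H : Set (X → Bool)} (φ : (X → Bool) → ℝ) (Q : PMF H) : ℝ :=
  ∑' h : H, (Q h).toReal * φ h

section Population

variable {X A : Type*} [MeasurableSpace X] [MeasurableSpace A]

/-- `err(h) = P[h(X) ≠ Y]`. -/
noncomputable def err (D : Measure (Ex X A)) (h : X → Bool) : ℝ :=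
  D.real {z | h z.1 ≠ z.2.2}

/-- `μ(h) = E[g(X, A, Y, h(X)) | E]`. -/
noncomputable def moment (D : Measure (Ex X A)) (g : X × A × Bool × Bool → ℝ)
    (E : Set (Ex X A)) (h : X → Bool) : ℝ :=
  ∫ z, g (z.1, z.2.1, z.2.2, h z.1) ∂(ProbabilityTheory.cond D E)

/-- `γ_k(Q) = ∑ j, M k j * μ_j(Q)`. -/
noncomputable def constr {J K : Type*} [Fintype J] {H : Set (X → Bool)} (D : Measure (Ex X A))
    (g : J → X × A × Bool × Bool → ℝ) (E : J → Set (Ex X A)) (M : Matrix K J ℝ)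
    (Q : PMF H) (k : K) : ℝ :=
  ∑ j, M k j * mix (moment D (g j) (E j)) Q

/-- `Q` minimizes `err` over all randomized classifiers, subject to `M μ(Q) ≤ c`. -/
def IsOptimal {J K : Type*} [Fintype J] {H : Set (X → Bool)} (D : Measure (Ex X A))
    (g : J → X × A × Bool × Bool → ℝ) (E : J → Set (Ex X A)) (M : Matrix K J ℝ) (c : K → ℝ)
    (Q : PMF H) : Prop :=
  (∀ k, constr D g E M Q k ≤ c k) ∧
    ∀ Q' : PMF H, (∀ k, constr D g E M Q' k ≤ c k) → mix (err D) Q ≤ mix (err D) Q'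

end Population

section Empirical

variable {X A : Type*} {n : ℕ}

/-- The empirical error of `h` on the sample `S`: the fraction of misclassified examples. -/
noncomputable def empErr (S : Fin n → Ex X A) (h : X → Bool) : ℝ :=
  (∑ i, if h (S i).1 ≠ (S i).2.2 then (1 : ℝ) else 0) / n

open Classical in
/-- The indices of the sample points that fall in the event `E`. -/
noncomputable def hits (S : Fin n → Ex X A) (E : Set (Ex X A)) : Finset (Fin n) :=
  Finset.univ.filter fun i => S i ∈ E

/-- The empirical conditional moment: the average of `g(X, A, Y, h(X))` over the sample points
that fall in `E`. -/
noncomputable def empMoment (S : Fin n → Ex X A) (g : X × A × Bool × Bool → ℝ)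
    (E : Set (Ex X A)) (h : X → Bool) : ℝ :=
  (∑ i ∈ hits S E, g ((S i).1, (S i).2.1, (S i).2.2, h (S i).1)) / (hits S E).card

variable {J K : Type*} [Fintype J]

/-- The empirical version of `γ_k(Q)`. -/
noncomputable def empConstr {H : Set (X → Bool)} (S : Fin n → Ex X A)
    (g : J → X × A × Bool × Bool → ℝ) (E : J → Set (Ex X A)) (M : Matrix K J ℝ)
    (Q : PMF H) (k : K) : ℝ :=
  ∑ j, M k j * mix (empMoment S (g j) (E j)) Q

/-- The slack condition `ε_k ≥ ∑ j, |M k j| (2 R_{n_j}(H) + 2 / √n_j + √(ln (2 / δ) / (2 n_j)))`,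
where `n_j` counts the sample points in `E_j`. The summand of `j` is infinite when `n_j = 0` and
`M k j ≠ 0`, so no `ε` qualifies then. -/
def IsSlack (S : Fin n → Ex X A) (H : Set (X → Bool)) (E : J → Set (Ex X A)) (M : Matrix K J ℝ)
    (δ : ℝ) (ε : K → ℝ) : Prop :=
  ∀ k, (∀ j, M k j ≠ 0 → 0 < (hits S (E j)).card) ∧
    ∑ j, |M k j| * radius H δ (hits S (E j)).card ≤ ε k

variable [Fintype K]

/-- The Lagrangian `L(Q, l)`, with right-hand sides `c'` of the empirical constraints. -/
noncomputable def lagrangian {H : Set (X → Bool)} (S : Fin n → Ex X A)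
    (g : J → X × A × Bool × Bool → ℝ) (E : J → Set (Ex X A)) (M : Matrix K J ℝ) (c' : K → ℝ)
    (Q : PMF H) (l : K → ℝ) : ℝ :=
  mix (empErr S) Q + ∑ k, l k * (empConstr S g E M Q k - c' k)

/-- The dual domain: nonnegative vectors of `ℓ₁` norm at most `B`. -/
def dualDomain (K : Type*) [Fintype K] (B : ℝ) : Set (K → ℝ) :=
  {l | (∀ k, 0 ≤ l k) ∧ ∑ k, |l k| ≤ B}

/-- `(Q, l)` is a `ν`-approximate saddle point of the Lagrangian. -/
def IsApproxSaddle {H : Set (X → Bool)} (S : Fin n → Ex X A)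
    (g : J → X × A × Bool × Bool → ℝ) (E : J → Set (Ex X A)) (M : Matrix K J ℝ) (c' : K → ℝ)
    (B ν : ℝ) (Q : PMF H) (l : K → ℝ) : Prop :=
  l ∈ dualDomain K B ∧
    (∀ Q' : PMF H, lagrangian S g E M c' Q l ≤ lagrangian S g E M c' Q' l + ν) ∧
    ∀ l' ∈ dualDomain K B, lagrangian S g E M c' Q l' - ν ≤ lagrangian S g E M c' Q l

end Empirical

end FairClassification

open FairClassification

namespace FairClassification

section BoundedDifferences

variable {Z : Type*} [MeasurableSpace Z]

/-- Hoeffding's lemma for a function whose values differ by at most `c`. -/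
theorem integral_exp_sub_integral_le (P : Measure Z) [IsProbabilityMeasure P] {f : Z → ℝ}
    (hf : Measurable f) {c : ℝ} (hc : ∀ x x', |f x - f x'| ≤ c) (t : ℝ) :
    ∫ x, Real.exp (t * (f x - ∫ x', f x' ∂P)) ∂P ≤ Real.exp (t ^ 2 * c ^ 2 / 8) := by
  obtain ⟨x₀⟩ : Nonempty Z := nonempty_of_isProbabilityMeasure P
  have hbdd : BddBelow (Set.range f) := ⟨f x₀ - c, by
    rintro _ ⟨x, rfl⟩
    linarith [(abs_le.1 (hc x₀ x)).2]⟩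
  have : Nonempty Z := ⟨x₀⟩
  have hmem : ∀ x, f x ∈ Set.Icc (⨅ x', f x') ((⨅ x', f x') + c) := fun x =>
    ⟨ciInf_le hbdd x, by
      have : f x - c ≤ ⨅ x', f x' := le_ciInf fun x' => by linarith [(abs_le.1 (hc x x')).2]
      linarith⟩
  have h := (ProbabilityTheory.hasSubgaussianMGF_of_mem_Icc (μ := P) hf.aemeasurable
    (ae_of_all _ hmem)).mgf_le t
  refine (show _ = _ from rfl).trans_le (h.trans_eq ?_)
  congr 1
  simp [div_pow, sq_abs]
  ring

/-- The moment generating function bound behind McDiarmid's inequality. -/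
theorem integral_exp_sub_integral_pi_le (P : Measure Z) [IsProbabilityMeasure P] {c b : ℝ} :
    ∀ (n : ℕ) {F : (Fin n → Z) → ℝ}, Measurable F → (∀ z, |F z| ≤ b) →
      (∀ z i x, |F z - F (Function.update z i x)| ≤ c) → ∀ t : ℝ,
      ∫ z, Real.exp (t * (F z - ∫ z', F z' ∂(Measure.pi fun _ => P)))
        ∂(Measure.pi fun _ => P) ≤ Real.exp (t ^ 2 * (n * c ^ 2) / 8) := by
  intro n
  induction n with
  | zero =>
    intro F _ _ _ t
    have : ∀ z, F z = ∫ z', F z' ∂(Measure.pi fun _ : Fin 0 => P) := fun z => by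
      have h : ∀ z', F z' = F z := fun z' => congrArg F (Subsingleton.elim _ _)
      simp [h]
    refine le_of_eq ?_
    calc _ = ∫ _z, Real.exp 0 ∂(Measure.pi fun _ : Fin 0 => P) :=
          integral_congr_ae (ae_of_all _ fun z => by simp only [this z, sub_self, mul_zero])
      _ = _ := by simp
  | succ n ih =>
    intro F hF hb hc t
    set π : Measure (Fin n → Z) := Measure.pi fun _ => P with hπ
    have hmp := (measurePreserving_piFinSuccAbove (fun _ : Fin (n + 1) => P) 0).symm
    set e := (MeasurableEquiv.piFinSuccAbove (fun _ : Fin (n + 1) => Z) 0).symm with he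
    have hchange : ∀ φ : (Fin (n + 1) → Z) → ℝ, ∫ z, φ z ∂(Measure.pi fun _ => P)
        = ∫ p, φ (e p) ∂(P.prod π) := fun φ => (hmp.integral_comp' φ).symm
    have hFe : Measurable fun p => F (e p) := hF.comp e.measurable
    have hint : Integrable (fun p => F (e p)) (P.prod π) :=
      Integrable.of_bound hFe.aestronglyMeasurable b (ae_of_all _ fun p => hb _)
    set G : (Fin n → Z) → ℝ := fun y => ∫ x, F (e (x, y)) ∂P with hG
    have hGm : Measurable G :=
      (hFe.stronglyMeasurable.integral_prod_left' (μ := P)).measurable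
    have hsec : ∀ y, Integrable (fun x => F (e (x, y))) P := fun y =>
      Integrable.of_bound (hFe.comp measurable_prodMk_right).aestronglyMeasurable b
        (ae_of_all _ fun p => hb _)
    have hGb : ∀ y, |G y| ≤ b := fun y => by
      have := norm_integral_le_of_norm_le_const (μ := P) (f := fun x => F (e (x, y)))
        (ae_of_all _ fun x => hb _)
      simpa using this
    have hGc : ∀ y i x, |G y - G (Function.update y i x)| ≤ c := fun y i x => by
      rw [hG]
      simp only
      rw [← integral_sub (hsec _) (hsec _)]
      have := norm_integral_le_of_norm_le_const (μ := P) (C := c)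
        (f := fun x' => F (e (x', y)) - F (e (x', Function.update y i x)))
        (ae_of_all _ fun x' => by
          have h := hc (e (x', y)) i.succ x
          have h2 : Function.update (e (x', y)) i.succ x = e (x', Function.update y i x) := by
            simp [he, MeasurableEquiv.piFinSuccAbove, Fin.insertNthEquiv]
          rw [h2] at h
          exact h)
      simpa using this
    have hmean : ∫ z, F z ∂(Measure.pi fun _ => P) = ∫ y, G y ∂π := by
      rw [hchange, integral_prod_symm _ hint]
    have hupd : ∀ (y : Fin n → Z) (x x' : Z), Function.update (e (x, y)) 0 x' = e (x', y) := by
      intro y x x'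
      simp [he, MeasurableEquiv.piFinSuccAbove, Fin.insertNthEquiv]
    have hexp : ∀ a, |a| ≤ b + b → |Real.exp (t * a)| ≤ Real.exp (|t| * (b + b)) := fun a ha => by
      rw [Real.abs_exp]
      refine Real.exp_le_exp.2 ((le_abs_self _).trans ?_)
      rw [abs_mul]
      gcongr
    set m := ∫ y, G y ∂π with hm
    have hmb : |m| ≤ b := by
      have := norm_integral_le_of_norm_le_const (μ := π) (f := G) (ae_of_all _ fun x => hGb x)
      simpa using this
    rw [hmean, hchange]
    have hmeas : Measurable fun p => Real.exp (t * (F (e p) - m)) := by fun_prop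
    have hint2 : Integrable (fun p => Real.exp (t * (F (e p) - m))) (P.prod π) :=
      Integrable.of_bound hmeas.aestronglyMeasurable (Real.exp (|t| * (b + b)))
        (ae_of_all _ fun p => hexp _ ((abs_sub _ _).trans (add_le_add (hb _) hmb)))
    rw [integral_prod_symm _ hint2]
    calc ∫ y, ∫ x, Real.exp (t * (F (e (x, y)) - m)) ∂P ∂π
        ≤ ∫ y, Real.exp (t ^ 2 * c ^ 2 / 8) * Real.exp (t * (G y - m)) ∂π := by
          refine integral_mono hint2.integral_prod_right ?_ fun y => ?_
          · refine Integrable.const_mul (Integrable.of_bound (by fun_prop)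
              (Real.exp (|t| * (b + b))) (ae_of_all _ fun p => ?_)) _
            exact hexp _ ((abs_sub _ _).trans (add_le_add (hGb _) hmb))
          · have h1 : ∀ x, Real.exp (t * (F (e (x, y)) - m))
                = Real.exp (t * (F (e (x, y)) - G y)) * Real.exp (t * (G y - m)) := fun x => by
              rw [← Real.exp_add]
              ring_nf
            simp only [h1]
            rw [integral_mul_const]
            gcongr
            refine integral_exp_sub_integral_le P (f := fun x => F (e (x, y)))
              (hFe.comp measurable_prodMk_right) (fun x x' => ?_) t
            have h := hc (e (x, y)) 0 x'
            rwa [hupd] at h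
      _ ≤ Real.exp (t ^ 2 * c ^ 2 / 8) * Real.exp (t ^ 2 * (n * c ^ 2) / 8) := by
          rw [integral_const_mul]
          gcongr
          exact ih hGm hGb hGc t
      _ = _ := by
          rw [← Real.exp_add]
          push_cast
          ring_nf

/-- **McDiarmid's inequality** for identically distributed coordinates. -/
theorem measureReal_pi_bounded_differences_le (P : Measure Z) [IsProbabilityMeasure P] {c b : ℝ}
    {n : ℕ} {F : (Fin n → Z) → ℝ} (hF : Measurable F) (hb : ∀ z, |F z| ≤ b)
    (hc : ∀ z i x, |F z - F (Function.update z i x)| ≤ c) {ε : ℝ} (hε : 0 ≤ ε) :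
    (Measure.pi fun _ : Fin n => P).real {z | ε ≤ F z - ∫ z', F z' ∂(Measure.pi fun _ => P)}
      ≤ Real.exp (-(2 * ε ^ 2) / (n * c ^ 2)) := by
  set π : Measure (Fin n → Z) := Measure.pi fun _ => P with hπ
  set m := ∫ z', F z' ∂π with hm
  have hsub : ProbabilityTheory.HasSubgaussianMGF (fun z => F z - m)
      (n * (‖c‖₊ / 2) ^ 2) π := by
    refine ⟨fun t => ?_, fun t => ?_⟩
    · refine Integrable.of_bound (by fun_prop) (Real.exp (|t| * (b + |m|)))
        (ae_of_all _ fun z => ?_)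
      rw [Real.norm_eq_abs, Real.abs_exp]
      refine Real.exp_le_exp.2 ((le_abs_self _).trans ?_)
      rw [abs_mul]
      gcongr
      exact (abs_sub _ _).trans (by gcongr; exact hb z)
    · refine (integral_exp_sub_integral_pi_le P n hF hb hc t).trans_eq ?_
      congr 1
      simp [div_pow, sq_abs]
      ring
  refine (hsub.measure_ge_le hε).trans_eq ?_
  congr 1
  simp only [NNReal.coe_mul, NNReal.coe_natCast, NNReal.coe_pow, NNReal.coe_div, coe_nnnorm,
    Real.norm_eq_abs, NNReal.coe_ofNat, div_pow, sq_abs]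
  rw [show 2 * ((n : ℝ) * (c ^ 2 / 2 ^ 2)) = (n * c ^ 2) / 2 by ring, div_div_eq_mul_div]
  ring

end BoundedDifferences

section Symmetrization

theorem abs_average_le_one {m : ℕ} {a : Fin m → ℝ} (ha : ∀ k, |a k| ≤ 1) :
    |(1 / (m : ℝ)) * ∑ k, a k| ≤ 1 := by
  rcases m.eq_zero_or_pos with rfl | hm
  · simp
  have hm' : (0 : ℝ) < m := by exact_mod_cast hm
  rw [abs_mul, abs_of_pos (one_div_pos.2 hm'), one_div_mul_eq_div, div_le_one hm']
  calc |∑ k, a k| ≤ ∑ k, |a k| := Finset.abs_sum_le_sum_abs _ _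
    _ ≤ ∑ _k : Fin m, (1 : ℝ) := Finset.sum_le_sum fun k _ => ha k
    _ = m := by simp

theorem abs_intUnits_coe (u : ℤˣ) : |((u : ℤ) : ℝ)| = 1 := by
  rcases Int.units_eq_one_or u with rfl | rfl <;> simp

theorem bddAbove_range_of_le {ι : Type*} {φ : ι → ℝ} {b : ℝ} (h : ∀ i, φ i ≤ b) :
    BddAbove (Set.range φ) :=
  ⟨b, by rintro _ ⟨i, rfl⟩; exact h i⟩

theorem abs_iSup_sub_iSup_le {ι : Type*} [Nonempty ι] {φ ψ : ι → ℝ} {b c : ℝ}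
    (hφ : ∀ i, φ i ≤ b) (hψ : ∀ i, ψ i ≤ b) (h : ∀ i, |φ i - ψ i| ≤ c) :
    |(⨆ i, φ i) - ⨆ i, ψ i| ≤ c := by
  rw [abs_sub_le_iff]
  constructor
  · have : ⨆ i, φ i ≤ c + ⨆ i, ψ i := ciSup_le fun i => by
      have := le_ciSup (bddAbove_range_of_le hψ) i
      linarith [(abs_le.1 (h i)).2]
    linarith
  · have : ⨆ i, ψ i ≤ c + ⨆ i, φ i := ciSup_le fun i => by
      have := le_ciSup (bddAbove_range_of_le hφ) i
      linarith [(abs_le.1 (h i)).1]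
    linarith

variable {Z ι : Type*} {m : ℕ}

/-- The empirical Rademacher complexity of a family `f` on the points `z`. -/
noncomputable def empRademacher (f : ι → Z → ℝ) (z : Fin m → Z) : ℝ :=
  (∑ σ : Fin m → ℤˣ, ⨆ i, |(1 / (m : ℝ)) * ∑ k, (((σ k : ℤˣ) : ℤ) : ℝ) * f i (z k)|) / 2 ^ m

variable {f : ι → Z → ℝ}

theorem abs_sub_le_one_of_mem_Icc {a b : ℝ} (ha : a ∈ Set.Icc (0 : ℝ) 1)
    (hb : b ∈ Set.Icc (0 : ℝ) 1) : |a - b| ≤ 1 :=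
  abs_le.2 ⟨by linarith [ha.1, hb.2], by linarith [ha.2, hb.1]⟩

theorem average_mem_Icc {a : Fin m → ℝ} (ha : ∀ k, a k ∈ Set.Icc (0 : ℝ) 1) :
    (1 / (m : ℝ)) * ∑ k, a k ∈ Set.Icc (0 : ℝ) 1 :=
  ⟨mul_nonneg (by positivity) (Finset.sum_nonneg fun k _ => (ha k).1),
    (le_abs_self _).trans (abs_average_le_one fun k => by
      rw [abs_of_nonneg (ha k).1]; exact (ha k).2)⟩

/-- The supremum of the signed averages of `f i (w k).1 - f i (w k).2`. -/
noncomputable def signedDifference (f : ι → Z → ℝ) (σ : Fin m → ℤˣ) (w : Fin m → Z × Z) : ℝ :=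
  ⨆ i, |(1 / (m : ℝ)) * ∑ k, (((σ k : ℤˣ) : ℤ) : ℝ) * (f i (w k).1 - f i (w k).2)|

theorem abs_signedAverage_le_one {ψ : Z → ℝ} (h : ∀ z, |ψ z| ≤ 1) (σ : Fin m → ℤˣ)
    (z : Fin m → Z) : |(1 / (m : ℝ)) * ∑ k, (((σ k : ℤˣ) : ℤ) : ℝ) * ψ (z k)| ≤ 1 :=
  abs_average_le_one fun k => by
    rw [abs_mul, abs_intUnits_coe, one_mul]
    exact h _

theorem abs_signedDifferenceAverage_le_one (h01 : ∀ i z, f i z ∈ Set.Icc (0 : ℝ) 1)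
    (σ : Fin m → ℤˣ) (w : Fin m → Z × Z) (i : ι) :
    |(1 / (m : ℝ)) * ∑ k, (((σ k : ℤˣ) : ℤ) : ℝ) * (f i (w k).1 - f i (w k).2)| ≤ 1 :=
  abs_signedAverage_le_one (ψ := fun p : Z × Z => f i p.1 - f i p.2)
    (fun p => abs_sub_le_one_of_mem_Icc (h01 i p.1) (h01 i p.2)) σ w

theorem abs_signedDifference_le_one [Nonempty ι] (h01 : ∀ i z, f i z ∈ Set.Icc (0 : ℝ) 1)
    (σ : Fin m → ℤˣ) (w : Fin m → Z × Z) : |signedDifference f σ w| ≤ 1 := by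
  rw [signedDifference, abs_of_nonneg (Real.iSup_nonneg fun i => abs_nonneg _)]
  exact ciSup_le (abs_signedDifferenceAverage_le_one h01 σ w)

theorem signedDifference_le [Nonempty ι] (h01 : ∀ i z, f i z ∈ Set.Icc (0 : ℝ) 1)
    (σ : Fin m → ℤˣ) (w : Fin m → Z × Z) :
    signedDifference f σ w
      ≤ (⨆ i, |(1 / (m : ℝ)) * ∑ k, (((σ k : ℤˣ) : ℤ) : ℝ) * f i (w k).1|)
        + ⨆ i, |(1 / (m : ℝ)) * ∑ k, (((σ k : ℤˣ) : ℤ) : ℝ) * f i (w k).2| := by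
  have hb : ∀ i z, |f i z| ≤ 1 := fun i z => by
    rw [abs_of_nonneg (h01 i z).1]
    exact (h01 i z).2
  refine ciSup_le fun i => ?_
  simp only [mul_sub, Finset.sum_sub_distrib]
  refine (abs_sub _ _).trans (add_le_add ?_ ?_)
  · exact le_ciSup (f := fun i => |(1 / (m : ℝ)) * ∑ k, (((σ k : ℤˣ) : ℤ) : ℝ) * f i (w k).1|)
      (bddAbove_range_of_le fun i => abs_signedAverage_le_one (hb i) σ fun k => (w k).1) i
  · exact le_ciSup (f := fun i => |(1 / (m : ℝ)) * ∑ k, (((σ k : ℤˣ) : ℤ) : ℝ) * f i (w k).2|)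
      (bddAbove_range_of_le fun i => abs_signedAverage_le_one (hb i) σ fun k => (w k).2) i

variable [MeasurableSpace Z]

/-- The largest deviation of an empirical mean of a member of the family `f` on the sample `z` from
its expectation. -/
noncomputable def uniformDeviation (P : Measure Z) (f : ι → Z → ℝ) (z : Fin m → Z) : ℝ :=
  ⨆ i, |(1 / (m : ℝ)) * ∑ k, f i (z k) - ∫ x, f i x ∂P|

theorem measurable_uniformDeviation [Countable ι] {P : Measure Z} (hf : ∀ i, Measurable (f i)) :
    Measurable (uniformDeviation (m := m) P f) := by
  unfold uniformDeviation
  refine Measurable.iSup fun i => ?_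
  have := hf i
  fun_prop

variable {P : Measure Z} [IsProbabilityMeasure P]

theorem integral_mem_Icc {φ : Z → ℝ} (hφ : Measurable φ) (h01 : ∀ z, φ z ∈ Set.Icc (0 : ℝ) 1) :
    ∫ x, φ x ∂P ∈ Set.Icc (0 : ℝ) 1 := by
  refine ⟨integral_nonneg fun z => (h01 z).1, ?_⟩
  have hi : Integrable φ P := Integrable.of_bound hφ.aestronglyMeasurable 1
    (ae_of_all _ fun z => by rw [Real.norm_eq_abs, abs_of_nonneg (h01 z).1]; exact (h01 z).2)
  simpa using integral_mono hi (integrable_const (1 : ℝ)) fun z => (h01 z).2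

theorem abs_average_sub_integral_le_one (hf : ∀ i, Measurable (f i))
    (h01 : ∀ i z, f i z ∈ Set.Icc (0 : ℝ) 1) (z : Fin m → Z) (i : ι) :
    |(1 / (m : ℝ)) * ∑ k, f i (z k) - ∫ x, f i x ∂P| ≤ 1 :=
  abs_sub_le_one_of_mem_Icc (average_mem_Icc fun k => h01 i (z k))
    (integral_mem_Icc (hf i) (h01 i))

theorem le_uniformDeviation (hf : ∀ i, Measurable (f i))
    (h01 : ∀ i z, f i z ∈ Set.Icc (0 : ℝ) 1) (z : Fin m → Z) (i : ι) :
    |(1 / (m : ℝ)) * ∑ k, f i (z k) - ∫ x, f i x ∂P| ≤ uniformDeviation P f z :=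
  le_ciSup (bddAbove_range_of_le (abs_average_sub_integral_le_one hf h01 z)) i

theorem abs_uniformDeviation_le_one [Nonempty ι] (hf : ∀ i, Measurable (f i))
    (h01 : ∀ i z, f i z ∈ Set.Icc (0 : ℝ) 1) (z : Fin m → Z) :
    |uniformDeviation P f z| ≤ 1 := by
  rw [uniformDeviation, abs_of_nonneg (Real.iSup_nonneg fun i => abs_nonneg _)]
  exact ciSup_le (abs_average_sub_integral_le_one hf h01 z)

theorem abs_uniformDeviation_sub_update_le [Nonempty ι] (hf : ∀ i, Measurable (f i))
    (h01 : ∀ i z, f i z ∈ Set.Icc (0 : ℝ) 1) (z : Fin m → Z) (k : Fin m) (x : Z) :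
    |uniformDeviation P f z - uniformDeviation P f (Function.update z k x)| ≤ 1 / m := by
  refine abs_iSup_sub_iSup_le (abs_average_sub_integral_le_one hf h01 z)
    (abs_average_sub_integral_le_one hf h01 _) fun i => ?_
  refine (abs_abs_sub_abs_le_abs_sub _ _).trans ?_
  rw [sub_sub_sub_cancel_right, ← mul_sub, ← Finset.sum_sub_distrib,
    Finset.sum_eq_single k (fun j _ hj => by simp [Function.update_of_ne hj]) (by simp), abs_mul,
    abs_of_nonneg (by positivity)]
  simpa using mul_le_mul_of_nonneg_left
    (abs_sub_le_one_of_mem_Icc (h01 i (z k)) (h01 i x)) (by positivity : (0 : ℝ) ≤ 1 / m)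

theorem measurable_signedDifference [Countable ι] (hf : ∀ i, Measurable (f i))
    (σ : Fin m → ℤˣ) : Measurable (signedDifference f σ) := by
  unfold signedDifference
  refine Measurable.iSup fun i => ?_
  have := hf i
  fun_prop

/-- Exchanging the two samples at some of the indices does not change the distribution. -/
theorem integral_signedDifference_eq [Countable ι] (hf : ∀ i, Measurable (f i))
    (σ : Fin m → ℤˣ) :
    ∫ w, signedDifference f 1 w ∂(Measure.pi fun _ : Fin m => P.prod P)
      = ∫ w, signedDifference f σ w ∂(Measure.pi fun _ : Fin m => P.prod P) := by
  set s : Fin m → Z × Z → Z × Z := fun k => if σ k = 1 then id else Prod.swap with hs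
  have hmp := measurePreserving_pi (fun _ : Fin m => P.prod P) (fun _ : Fin m => P.prod P)
    (f := s) fun k => by
      by_cases h : σ k = 1
      · simpa [hs, h] using MeasurePreserving.id (P.prod P)
      · simpa [hs, h] using Measure.measurePreserving_swap (μ := P) (ν := P)
  conv_lhs => rw [← hmp.map_eq]
  rw [integral_map hmp.aemeasurable (measurable_signedDifference hf 1).aestronglyMeasurable]
  refine integral_congr_ae (ae_of_all _ fun w => ?_)
  simp only [signedDifference]
  refine congrArg _ (funext fun i => ?_)
  congr 2
  refine Finset.sum_congr rfl fun k _ => ?_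
  rcases Int.units_eq_one_or (σ k) with h | h <;> simp [hs, h]

/-- The symmetrization inequality. -/
theorem integral_uniformDeviation_le [Countable ι] [Nonempty ι] (hf : ∀ i, Measurable (f i))
    (h01 : ∀ i z, f i z ∈ Set.Icc (0 : ℝ) 1) (hm : 0 < m) {C : ℝ}
    (hC : ∀ z : Fin m → Z, empRademacher f z ≤ C) :
    ∫ z, uniformDeviation P f z ∂(Measure.pi fun _ : Fin m => P) ≤ 2 * C := by
  set π : Measure (Fin m → Z) := Measure.pi fun _ => P with hπ
  set ρ : Measure (Fin m → Z × Z) := Measure.pi fun _ => P.prod P with hρ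
  have hmp := measurePreserving_arrowProdEquivProdArrow Z Z (Fin m) (fun _ => P) (fun _ => P)
  set e := MeasurableEquiv.arrowProdEquivProdArrow Z Z (Fin m) with he
  set W : (Fin m → Z × Z) → ℝ := signedDifference f 1 with hW
  have hWm : Measurable W := measurable_signedDifference hf 1
  have hWint : Integrable (fun p => W (e.symm p)) (π.prod π) :=
    Integrable.of_bound (hWm.comp e.symm.measurable).aestronglyMeasurable 1
      (ae_of_all _ fun p => abs_signedDifference_le_one h01 _ _)
  have hWsec : ∀ z, Integrable (fun z' => W (e.symm (z, z'))) π := fun z =>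
    Integrable.of_bound
      ((hWm.comp e.symm.measurable).comp measurable_prodMk_left).aestronglyMeasurable 1
      (ae_of_all _ fun p => abs_signedDifference_le_one h01 _ _)
  have hm' : (m : ℝ) ≠ 0 := by exact_mod_cast hm.ne'
  have hfint : ∀ i, Integrable (f i) P := fun i =>
    Integrable.of_bound (hf i).aestronglyMeasurable 1
      (ae_of_all _ fun z => by rw [Real.norm_eq_abs, abs_of_nonneg (h01 i z).1]; exact (h01 i z).2)
  have hfk : ∀ i k, Integrable (fun z' : Fin m → Z => f i (z' k)) π := fun i k =>
    (measurePreserving_eval (fun _ : Fin m => P) k).integrable_comp_of_integrable (hfint i)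
  have hfk' : ∀ i k, ∫ z', f i (z' k) ∂π = ∫ x, f i x ∂P := fun i k => by
    have h := measurePreserving_eval (fun _ : Fin m => P) k
    conv_rhs => rw [← h.map_eq]
    exact (integral_map h.aemeasurable (hf i).aestronglyMeasurable).symm
  have hghost : ∀ z, uniformDeviation P f z ≤ ∫ z', W (e.symm (z, z')) ∂π := fun z => by
    refine ciSup_le fun i => ?_
    have hrep : (1 / (m : ℝ)) * ∑ k, f i (z k) - ∫ x, f i x ∂P
        = ∫ z', (1 / (m : ℝ)) * ∑ k, (f i (z k) - f i (z' k)) ∂π := by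
      rw [integral_const_mul, integral_finsetSum Finset.univ
        (f := fun k (z' : Fin m → Z) => f i (z k) - f i (z' k)) fun k _ => (integrable_const _).sub (hfk i k)]
      simp_rw [integral_sub (integrable_const _) (hfk i _), hfk']
      simp [Finset.sum_sub_distrib, mul_sub, hm']
    rw [hrep]
    refine abs_integral_le_integral_abs.trans (integral_mono ?_ (hWsec z) fun z' => ?_)
    · exact ((integrable_finsetSum _ fun k _ =>
        (integrable_const _).sub (hfk i k)).const_mul _).abs
    · have := le_ciSup (bddAbove_range_of_le
        (abs_signedDifferenceAverage_le_one h01 (1 : Fin m → ℤˣ) (e.symm (z, z')))) i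
      simpa [W, signedDifference, he, MeasurableEquiv.arrowProdEquivProdArrow,
        Equiv.arrowProdEquivProdArrow] using this
  have h2 : (0 : ℝ) < 2 ^ m := by positivity
  calc ∫ z, uniformDeviation P f z ∂π
      ≤ ∫ z, ∫ z', W (e.symm (z, z')) ∂π ∂π := by
        refine integral_mono ?_ hWint.integral_prod_left hghost
        exact Integrable.of_bound (measurable_uniformDeviation hf).aestronglyMeasurable 1
          (ae_of_all _ fun z => abs_uniformDeviation_le_one hf h01 z)
    _ = ∫ w, W w ∂ρ := by
        rw [← integral_prod _ hWint, ← hmp.integral_comp']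
        simp [ρ]
    _ = (∑ σ : Fin m → ℤˣ, ∫ w, signedDifference f σ w ∂ρ) / 2 ^ m := by
        rw [Finset.sum_congr rfl fun σ _ => (integral_signedDifference_eq hf σ).symm]
        simp [W, ρ]
    _ = ∫ w, (∑ σ : Fin m → ℤˣ, signedDifference f σ w) / 2 ^ m ∂ρ := by
        rw [integral_div, integral_finsetSum _ fun σ _ => ?_]
        exact Integrable.of_bound (measurable_signedDifference hf σ).aestronglyMeasurable 1
          (ae_of_all _ fun z => abs_signedDifference_le_one h01 _ _)
    _ ≤ ∫ _w, 2 * C ∂ρ := by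
        refine integral_mono_of_nonneg (ae_of_all _ fun w => ?_) (integrable_const _)
          (ae_of_all _ fun w => ?_)
        · exact div_nonneg (Finset.sum_nonneg fun σ _ => Real.iSup_nonneg fun i => abs_nonneg _)
            h2.le
        · calc (∑ σ : Fin m → ℤˣ, signedDifference f σ w) / 2 ^ m
              ≤ empRademacher f (fun k => (w k).1) + empRademacher f fun k => (w k).2 := by
                rw [empRademacher, empRademacher, ← add_div, ← Finset.sum_add_distrib]
                gcongr with σ
                exact signedDifference_le h01 σ w
            _ ≤ 2 * C := by linarith [hC fun k => (w k).1, hC fun k => (w k).2]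
    _ = 2 * C := by simp

/-- The uniform deviation bound in terms of the Rademacher complexity. -/
theorem measureReal_uniformDeviation_le [Countable ι] [Nonempty ι] (hf : ∀ i, Measurable (f i))
    (h01 : ∀ i z, f i z ∈ Set.Icc (0 : ℝ) 1) (hm : 0 < m) {C t : ℝ} (ht : 0 ≤ t)
    (hC : ∀ z : Fin m → Z, empRademacher f z ≤ C) :
    (Measure.pi fun _ : Fin m => P).real {z | 2 * C + t < uniformDeviation P f z}
      ≤ Real.exp (-(2 * m * t ^ 2)) := by
  have hm' : (m : ℝ) ≠ 0 := by exact_mod_cast hm.ne'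
  have h := measureReal_pi_bounded_differences_le P (measurable_uniformDeviation (P := P) hf)
    (abs_uniformDeviation_le_one hf h01) (abs_uniformDeviation_sub_update_le (m := m) hf h01) ht
  refine (measureReal_mono fun z hz => ?_).trans (h.trans_eq ?_)
  · have := integral_uniformDeviation_le (P := P) hf h01 hm hC
    simp only [Set.mem_ofPred_eq] at hz ⊢
    linarith
  · congr 1
    field_simp

end Symmetrization

section Contraction

variable {ι : Type*} {m : ℕ}

theorem abs_average_mul_le (σ : Fin m → ℤˣ) (d : Fin m → ℝ) {a : Fin m → ℝ}
    (ha : ∀ k, |a k| ≤ 1) :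
    |(1 / (m : ℝ)) * ∑ k, (((σ k : ℤˣ) : ℤ) : ℝ) * (d k * a k)| ≤ (1 / (m : ℝ)) * ∑ k, |d k| := by
  rw [abs_mul, abs_of_nonneg (by positivity : (0 : ℝ) ≤ 1 / m)]
  gcongr
  refine (Finset.abs_sum_le_sum_abs _ _).trans (Finset.sum_le_sum fun k _ => ?_)
  rw [abs_mul, abs_intUnits_coe, one_mul, abs_mul]
  exact mul_le_of_le_one_right (abs_nonneg _) (ha k)

theorem convexOn_empRademacher_mul [Nonempty ι] {a : ι → Fin m → ℝ} (ha : ∀ i k, |a i k| ≤ 1) :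
    ConvexOn ℝ Set.univ fun d : Fin m → ℝ => empRademacher (fun i k => d k * a i k) id := by
  refine ⟨convex_univ, fun d _ d' _ α β hα hβ _ => ?_⟩
  simp only [empRademacher, smul_eq_mul, id]
  rw [← mul_div_assoc, ← mul_div_assoc, ← add_div, Finset.mul_sum, Finset.mul_sum,
    ← Finset.sum_add_distrib]
  gcongr with σ
  refine ciSup_le fun i => ?_
  have hsplit : (1 / (m : ℝ)) * ∑ k, (((σ k : ℤˣ) : ℤ) : ℝ) * ((α • d + β • d') k * a i k)
      = α * ((1 / (m : ℝ)) * ∑ k, (((σ k : ℤˣ) : ℤ) : ℝ) * (d k * a i k))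
        + β * ((1 / (m : ℝ)) * ∑ k, (((σ k : ℤˣ) : ℤ) : ℝ) * (d' k * a i k)) := by
    simp only [Finset.mul_sum, ← Finset.sum_add_distrib]
    refine Finset.sum_congr rfl fun k _ => ?_
    simp only [Pi.add_apply, Pi.smul_apply, smul_eq_mul]
    ring
  rw [hsplit]
  refine (abs_add_le _ _).trans ?_
  rw [abs_mul α, abs_mul β, abs_of_nonneg hα, abs_of_nonneg hβ]
  gcongr
  · exact le_ciSup (f := fun i => |(1 / (m : ℝ)) * ∑ k, (((σ k : ℤˣ) : ℤ) : ℝ) * (d k * a i k)|)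
      (bddAbove_range_of_le fun i => abs_average_mul_le σ d (ha i)) i
  · exact le_ciSup (f := fun i => |(1 / (m : ℝ)) * ∑ k, (((σ k : ℤˣ) : ℤ) : ℝ) * (d' k * a i k)|)
      (bddAbove_range_of_le fun i => abs_average_mul_le σ d' (ha i)) i

/-- The contraction principle: multipliers in `[-1, 1]` do not increase the Rademacher
complexity. -/
theorem empRademacher_mul_le [Nonempty ι] {a : ι → Fin m → ℝ} (ha : ∀ i k, |a i k| ≤ 1)
    {d : Fin m → ℝ} (hd : ∀ k, |d k| ≤ 1) :
    empRademacher (fun i k => d k * a i k) id ≤ empRademacher a id := by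
  have hmem : d ∈ convexHull ℝ (Set.univ.pi fun _ : Fin m => ({-1, 1} : Set ℝ)) := by
    rw [convexHull_pi]
    intro k _
    rw [convexHull_pair, segment_eq_Icc (by norm_num)]
    exact abs_le.1 (hd k)
  obtain ⟨τ, hτ, hle⟩ := (convexOn_empRademacher_mul ha).exists_ge_of_mem_convexHull
    (Set.subset_univ _) hmem
  refine hle.trans (le_of_eq ?_)
  have hunit : ∀ k, ∃ u : ℤˣ, ((u : ℤ) : ℝ) = τ k := fun k => by
    rcases hτ k (Set.mem_univ k) with h | h
    · exact ⟨-1, by simp [h]⟩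
    · exact ⟨1, by simp [Set.mem_singleton_iff.1 h]⟩
  choose u hu using hunit
  simp only [empRademacher, id]
  congr 1
  rw [← Equiv.sum_comp (Equiv.mulRight u)]
  refine Finset.sum_congr rfl fun σ _ => ?_
  refine congrArg _ (funext fun i => ?_)
  congr 2
  refine Finset.sum_congr rfl fun k _ => ?_
  have hsq : ((u k : ℤ) : ℝ) * ((u k : ℤ) : ℝ) = 1 := by
    rcases Int.units_eq_one_or (u k) with h | h <;> simp [h]
  simp only [Equiv.coe_mulRight, Pi.mul_apply, Units.val_mul, Int.cast_mul, ← hu k]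
  linear_combination (((σ k : ℤˣ) : ℤ) : ℝ) * a i k * hsq

theorem card_signVectors : Fintype.card (Fin m → ℤˣ) = 2 ^ m := by
  simp

theorem sum_sign_mul_sign (k l : Fin m) :
    ∑ σ : Fin m → ℤˣ, (((σ k : ℤˣ) : ℤ) : ℝ) * (((σ l : ℤˣ) : ℤ) : ℝ)
      = if k = l then 2 ^ m else 0 := by
  split_ifs with h
  · subst h
    have : ∀ u : ℤˣ, ((u : ℤ) : ℝ) * ((u : ℤ) : ℝ) = 1 := fun u => by
      rcases Int.units_eq_one_or u with h | h <;> simp [h]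
    simp [this]
  · have := Equiv.sum_comp (Equiv.mulRight (Pi.mulSingle k (-1) : Fin m → ℤˣ))
      fun σ : Fin m → ℤˣ => (((σ k : ℤˣ) : ℤ) : ℝ) * (((σ l : ℤˣ) : ℤ) : ℝ)
    simp [Pi.mulSingle_eq_of_ne (Ne.symm h)] at this
    linarith

/-- The mean absolute value of a signed average of `m` numbers in `[-1, 1]` is at most `1 / √m`. -/
theorem mean_abs_signedAverage_le (hm : 0 < m) {b : Fin m → ℝ} (hb : ∀ k, |b k| ≤ 1) :
    (∑ σ : Fin m → ℤˣ, |(1 / (m : ℝ)) * ∑ k, (((σ k : ℤˣ) : ℤ) : ℝ) * b k|) / 2 ^ m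
      ≤ 1 / √(m : ℝ) := by
  have hm' : (0 : ℝ) < m := by exact_mod_cast hm
  have hsq : ∑ σ : Fin m → ℤˣ, (∑ k, (((σ k : ℤˣ) : ℤ) : ℝ) * b k) ^ 2 ≤ 2 ^ m * m := by
    calc ∑ σ : Fin m → ℤˣ, (∑ k, (((σ k : ℤˣ) : ℤ) : ℝ) * b k) ^ 2
        = ∑ σ : Fin m → ℤˣ, ∑ k, ∑ l,
            b k * b l * ((((σ k : ℤˣ) : ℤ) : ℝ) * (((σ l : ℤˣ) : ℤ) : ℝ)) := by
          refine Finset.sum_congr rfl fun σ _ => ?_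
          rw [sq, Finset.sum_mul_sum]
          exact Finset.sum_congr rfl fun k _ => Finset.sum_congr rfl fun l _ => by ring
      _ = ∑ k, ∑ l, b k * b l * if k = l then 2 ^ m else 0 := by
          rw [Finset.sum_comm]
          refine Finset.sum_congr rfl fun k _ => ?_
          rw [Finset.sum_comm]
          exact Finset.sum_congr rfl fun l _ => by rw [← Finset.mul_sum, sum_sign_mul_sign]
      _ = ∑ k, b k ^ 2 * 2 ^ m := by simp [sq]
      _ ≤ ∑ _k : Fin m, (1 : ℝ) * 2 ^ m := by
          gcongr with k
          rw [← sq_abs]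
          exact pow_le_one₀ (abs_nonneg _) (hb k)
      _ = 2 ^ m * m := by simp [mul_comm]
  have hcs := sq_sum_le_card_mul_sum_sq (s := (Finset.univ : Finset (Fin m → ℤˣ)))
    (f := fun σ => |∑ k, (((σ k : ℤˣ) : ℤ) : ℝ) * b k|)
  simp only [sq_abs, Finset.card_univ, card_signVectors, Nat.cast_pow, Nat.cast_ofNat] at hcs
  have h2 : (0 : ℝ) < 2 ^ m := by positivity
  have hbound : ∑ σ : Fin m → ℤˣ, |∑ k, (((σ k : ℤˣ) : ℤ) : ℝ) * b k| ≤ 2 ^ m * √(m : ℝ) := by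
    refine abs_le_of_sq_le_sq' ?_ (by positivity) |>.2
    rw [mul_pow, Real.sq_sqrt hm'.le]
    nlinarith
  simp only [abs_mul, abs_of_pos (one_div_pos.2 hm'), ← Finset.mul_sum]
  rw [div_le_div_iff₀ h2 (Real.sqrt_pos.2 hm'), one_mul, one_div_mul_eq_div, div_mul_eq_mul_div,
    div_le_iff₀ hm']
  calc _ ≤ 2 ^ m * √(m : ℝ) * √(m : ℝ) := by gcongr
    _ = 2 ^ m * m := by rw [mul_assoc, Real.mul_self_sqrt hm'.le]

variable {X : Type*} {H : Set (X → Bool)}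

theorem abs_boolToReal_le_one (b : Bool) : |if b then (1 : ℝ) else 0| ≤ 1 := by
  cases b <;> simp

theorem abs_le_one_of_mem_realClass {f : X → ℝ} (hf : f ∈ realClass H) (x : X) : |f x| ≤ 1 := by
  obtain ⟨h, -, rfl⟩ := hf
  exact abs_boolToReal_le_one _

theorem empRademacher_le_rademacher [Nonempty ι] {u : ι → X → Bool} (hu : ∀ i, u i ∈ H)
    (x : Fin m → X) :
    empRademacher (fun i x => if u i x then (1 : ℝ) else 0) x ≤ rademacher (realClass H) m := by
  have hb : ∀ (y : Fin m → X) (σ : Fin m → ℤˣ) (f : realClass H),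
      |(1 / (m : ℝ)) * ∑ i, (((σ i : ℤˣ) : ℤ) : ℝ) * (f : X → ℝ) (y i)| ≤ 1 := fun y σ f =>
    abs_signedAverage_le_one (abs_le_one_of_mem_realClass f.2) σ y
  have hne : Nonempty (realClass H) :=
    (Classical.arbitrary ι : ι) |> fun i => ⟨⟨_, Set.mem_image_of_mem _ (hu i)⟩⟩
  refine le_trans ?_ (le_ciSup (bddAbove_range_of_le (b := 1) fun y => ?_) x)
  · rw [empRademacher]
    gcongr with σ
    refine ciSup_le fun i => ?_
    exact le_ciSup (bddAbove_range_of_le (hb x σ))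
      (⟨_, Set.mem_image_of_mem _ (hu i)⟩ : realClass H)
  · rw [div_le_one (by positivity)]
    calc _ ≤ ∑ _σ : Fin m → ℤˣ, (1 : ℝ) := Finset.sum_le_sum fun σ _ => ciSup_le (hb y σ)
      _ = 2 ^ m := by simp

theorem empRademacher_comp_le [Nonempty ι] {A : Type*} {u : ι → X → Bool} (hu : ∀ i, u i ∈ H)
    {g : X × A × Bool × Bool → ℝ} (hg : ∀ w, g w ∈ Set.Icc (0 : ℝ) 1) (hm : 0 < m)
    (z : Fin m → Ex X A) :
    empRademacher (fun i (z : Ex X A) => g (z.1, z.2.1, z.2.2, u i z.1)) z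
      ≤ rademacher (realClass H) m + 1 / √(m : ℝ) := by
  set b : Fin m → ℝ := fun k => g ((z k).1, (z k).2.1, (z k).2.2, false) with hb
  set d : Fin m → ℝ := fun k => g ((z k).1, (z k).2.1, (z k).2.2, true) - b k with hd
  set a : ι → Fin m → ℝ := fun i k => if u i (z k).1 then 1 else 0 with ha
  have hd1 : ∀ k, |d k| ≤ 1 := fun k => abs_sub_le_one_of_mem_Icc (hg _) (hg _)
  have hb1 : ∀ k, |b k| ≤ 1 := fun k => by
    rw [abs_of_nonneg (hg _).1]
    exact (hg _).2
  have ha1 : ∀ i k, |a i k| ≤ 1 := fun i k => abs_boolToReal_le_one _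
  have hg' : ∀ i k, g ((z k).1, (z k).2.1, (z k).2.2, u i (z k).1) = b k + d k * a i k :=
    fun i k => by
      cases h : u i (z k).1 <;> simp [hd, hb, ha, h]
  have hrad : empRademacher a id ≤ rademacher (realClass H) m :=
    empRademacher_le_rademacher hu fun k => (z k).1
  have hsum : empRademacher (fun i (z : Ex X A) => g (z.1, z.2.1, z.2.2, u i z.1)) z
      ≤ empRademacher (fun i k => d k * a i k) id
        + (∑ σ : Fin m → ℤˣ, |(1 / (m : ℝ)) * ∑ k, (((σ k : ℤˣ) : ℤ) : ℝ) * b k|) / 2 ^ m := by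
    rw [empRademacher, empRademacher, ← add_div, ← Finset.sum_add_distrib]
    gcongr with σ
    refine ciSup_le fun i => ?_
    simp only [hg', mul_add, Finset.sum_add_distrib]
    rw [add_comm (⨆ i, _)]
    refine (abs_add_le _ _).trans (add_le_add le_rfl ?_)
    exact le_ciSup (f := fun i => |(1 / (m : ℝ)) * ∑ k, (((σ k : ℤˣ) : ℤ) : ℝ) * (d k * a i k)|)
      (bddAbove_range_of_le fun i => abs_average_mul_le σ d (ha1 i)) i
  linarith [empRademacher_mul_le ha1 hd1, mean_abs_signedAverage_le hm hb1]

end Contraction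

section ConditionalSample

theorem measurableSet_mem_iff {Z : Type*} [MeasurableSpace Z] {E : Set Z} (hE : MeasurableSet E)
    (p : Prop) : MeasurableSet {x | x ∈ E ↔ p} := by
  by_cases hp : p
  · simp only [hp, iff_true]
    exact hE
  · simp only [hp, iff_false]
    exact hE.compl

/-- Given which members of an i.i.d. sample fall in `E`, those that do are an i.i.d. sample from the
conditional distribution. -/
theorem map_cond_pi {Z ι κ : Type*} [MeasurableSpace Z] [Fintype ι] [Fintype κ] (D : Measure Z)
    [IsProbabilityMeasure D] {E : Set Z} (hE : MeasurableSet E) (hDE : D E ≠ 0) (e : κ ↪ ι)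
    (hA : (Measure.pi fun _ : ι => D) (Set.univ.pi fun i => {x | x ∈ E ↔ i ∈ Set.range e}) ≠ 0) :
    (ProbabilityTheory.cond (Measure.pi fun _ : ι => D)
        (Set.univ.pi fun i => {x | x ∈ E ↔ i ∈ Set.range e})).map (fun S k => S (e k))
      = Measure.pi fun _ : κ => ProbabilityTheory.cond D E := by
  classical
  have : IsProbabilityMeasure (ProbabilityTheory.cond D E) :=
    ProbabilityTheory.cond_isProbabilityMeasure hDE
  set π : Measure (ι → Z) := Measure.pi fun _ => D with hπ
  have hAm : MeasurableSet (Set.univ.pi fun i : ι => {x | x ∈ E ↔ i ∈ Set.range e}) :=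
    MeasurableSet.univ_pi fun i => measurableSet_mem_iff hE _
  refine (Measure.pi_eq fun s hs => ?_).symm
  have hmeas : Measurable fun (S : ι → Z) (k : κ) => S (e k) := by fun_prop
  rw [Measure.map_apply hmeas (MeasurableSet.univ_pi hs), ProbabilityTheory.cond_apply hAm]
  set a : ι → Set Z := fun i => {x | x ∈ E ↔ i ∈ Set.range e} with ha
  set t : ι → Set Z := fun i => {x | x ∈ a i ∧ ∀ k, e k = i → x ∈ s k} with ht
  have hinter : Set.univ.pi a ∩ (fun (S : ι → Z) (k : κ) => S (e k)) ⁻¹' Set.univ.pi s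
      = Set.univ.pi t := by
    ext S
    simp only [Set.mem_inter_iff, Set.mem_pi, Set.mem_univ, forall_true_left, Set.mem_preimage,
      ht, Set.mem_ofPred_eq]
    constructor
    · rintro ⟨h1, h2⟩ i
      exact ⟨h1 i, fun k hk => hk ▸ h2 k⟩
    · intro h
      exact ⟨fun i => (h i).1, fun k => (h (e k)).2 k rfl⟩
  have hsplit : ∀ F : ι → ENNReal,
      ∏ i, F i = (∏ k, F (e k)) * ∏ i ∈ (Finset.univ.map e)ᶜ, F i := fun F => by
    rw [← Finset.prod_mul_prod_compl (Finset.univ.map e) F, Finset.prod_map]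
  have hae : ∀ k, a (e k) = E := fun k => by simp [ha]
  have hte : ∀ k, t (e k) = E ∩ s k := fun k => by
    ext x
    simp [ht, hae]
  have htc : ∀ i ∈ (Finset.univ.map e)ᶜ, D (t i) = D (a i) := fun i hi => by
    congr 1
    ext x
    simp only [Finset.mem_compl, Finset.mem_map, Finset.mem_univ, true_and, not_exists] at hi
    simp only [ht, Set.mem_ofPred_eq, and_iff_left_iff_imp]
    exact fun _ k hk => absurd hk (hi k)
  have hprod : π (Set.univ.pi t)
      = π (Set.univ.pi a) * ∏ k, ProbabilityTheory.cond D E (s k) := by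
    rw [hπ, Measure.pi_pi, Measure.pi_pi, hsplit, hsplit fun i => D (a i),
      Finset.prod_congr rfl htc, mul_right_comm, ← Finset.prod_mul_distrib]
    congr 1
    refine Finset.prod_congr rfl fun k _ => ?_
    rw [hte, hae, mul_comm, ProbabilityTheory.cond_mul_eq_inter hE]
  rw [hinter, hprod, ← mul_assoc, ENNReal.inv_mul_cancel hA (measure_ne_top _ _), one_mul]

variable {X A : Type*} {n : ℕ}

theorem hits_eq_iff {S : Fin n → Ex X A} {E : Set (Ex X A)} {I : Finset (Fin n)} :
    hits S E = I ↔ ∀ i, S i ∈ E ↔ i ∈ I := by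
  simp [hits, Finset.ext_iff]

theorem empMoment_eq_average {S : Fin n → Ex X A} {g : X × A × Bool × Bool → ℝ}
    {E : Set (Ex X A)} {h : X → Bool} {m : ℕ} (hm : (hits S E).card = m) :
    empMoment S g E h = (1 / (m : ℝ)) * ∑ k, (fun z : Ex X A => g (z.1, z.2.1, z.2.2, h z.1))
      (S ((hits S E).orderEmbOfFin hm k)) := by
  rw [empMoment, one_div_mul_eq_div, hm]
  congr 1
  conv_lhs => rw [← Finset.map_orderEmbOfFin_univ (hits S E) hm, Finset.sum_map]
  rfl

variable [MeasurableSpace X] [MeasurableSpace A]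

theorem measurable_comp_classifier {g : X × A × Bool × Bool → ℝ} (hg : Measurable g)
    {h : X → Bool} (hh : Measurable h) :
    Measurable fun z : Ex X A => g (z.1, z.2.1, z.2.2, h z.1) :=
  hg.comp (by fun_prop)

theorem exp_neg_two_mul_sq_le {δ : ℝ} (hδ : 0 < δ) (hδ1 : δ ≤ 1) {m : ℕ} (hm : 0 < m) :
    Real.exp (-(2 * m * √(Real.log (2 / δ) / (2 * (m : ℝ))) ^ 2)) ≤ δ := by
  have hm' : (m : ℝ) ≠ 0 := by exact_mod_cast hm.ne'
  have hlog : 0 ≤ Real.log (2 / δ) := Real.log_nonneg (by rw [le_div_iff₀ hδ]; linarith)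
  rw [Real.sq_sqrt (by positivity)]
  rw [show 2 * (m : ℝ) * (Real.log (2 / δ) / (2 * m)) = Real.log (2 / δ) by field_simp,
    Real.exp_neg, Real.exp_log (by positivity), inv_div]
  linarith

/-- Uniform convergence of the empirical conditional moments over a countable family. -/
theorem measure_exists_radius_lt_le {ι : Type*} [Countable ι] [Nonempty ι] (D : Measure (Ex X A))
    [IsProbabilityMeasure D] {H : Set (X → Bool)} {u : ι → X → Bool} (huH : ∀ i, u i ∈ H)
    (hu : ∀ i, Measurable (u i)) {g : X × A × Bool × Bool → ℝ} (hg : Measurable g)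
    (hg01 : ∀ w, g w ∈ Set.Icc (0 : ℝ) 1) {E : Set (Ex X A)} (hE : MeasurableSet E) {δ : ℝ}
    (hδ : 0 < δ) (hδ1 : δ ≤ 1) :
    (Measure.pi fun _ : Fin n => D) {S | 0 < (hits S E).card ∧ ∃ i,
        radius H δ (hits S E).card < |empMoment S g E (u i) - moment D g E (u i)|}
      ≤ ENNReal.ofReal δ := by
  set π : Measure (Fin n → Ex X A) := Measure.pi fun _ => D with hπ
  set f : ι → Ex X A → ℝ := fun i z => g (z.1, z.2.1, z.2.2, u i z.1) with hf
  have hfm : ∀ i, Measurable (f i) := fun i => measurable_comp_classifier hg (hu i)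
  have hf01 : ∀ i z, f i z ∈ Set.Icc (0 : ℝ) 1 := fun i z => hg01 _
  set B : Finset (Fin n) → Set (Fin n → Ex X A) := fun I =>
    {S | hits S E = I ∧ 0 < I.card ∧ ∃ i,
      radius H δ I.card < |empMoment S g E (u i) - moment D g E (u i)|} with hB
  have hAeq : ∀ I : Finset (Fin n), {S : Fin n → Ex X A | hits S E = I}
      = Set.univ.pi fun i => {x | x ∈ E ↔ i ∈ Set.range (I.orderEmbOfFin rfl).toEmbedding} :=
    fun I => by
      ext S
      have hr : ∀ i, (i ∈ Set.range (I.orderEmbOfFin rfl).toEmbedding) ↔ i ∈ I := fun i => by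
        have := Finset.range_orderEmbOfFin I rfl
        exact (Set.ext_iff.1 this i)
      simp only [Set.mem_pi, Set.mem_univ, forall_true_left, hr]
      exact hits_eq_iff
  have hAm : ∀ I : Finset (Fin n), MeasurableSet {S : Fin n → Ex X A | hits S E = I} := fun I => by
    rw [hAeq]
    exact MeasurableSet.univ_pi fun i => measurableSet_mem_iff hE _
  have hBI : ∀ I, π (B I) ≤ ENNReal.ofReal δ * π {S | hits S E = I} := fun I => by
    rcases I.eq_empty_or_nonempty with rfl | hI
    · simp [hB]
    have hm : 0 < I.card := hI.card_pos
    by_cases h0 : π {S | hits S E = I} = 0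
    · rw [measure_mono_null (fun S hS => hS.1) h0]
      exact zero_le
    have hDE : D E ≠ 0 := fun hDE => h0 <| by
      obtain ⟨i, hi⟩ := hI
      refine measure_mono_null (fun S hS => ?_)
        (Measure.pi_eval_preimage_null (fun _ => D) (i := i) hDE)
      exact (hits_eq_iff.1 hS i).2 hi
    have : IsProbabilityMeasure (ProbabilityTheory.cond D E) :=
      ProbabilityTheory.cond_isProbabilityMeasure hDE
    set P := ProbabilityTheory.cond D E with hP
    set e := (I.orderEmbOfFin rfl).toEmbedding with he
    set C := rademacher (realClass H) I.card + 1 / √(I.card : ℝ) with hC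
    set t := √(Real.log (2 / δ) / (2 * (I.card : ℝ))) with ht
    set V : Set (Fin I.card → Ex X A) := {z | 2 * C + t < uniformDeviation P f z} with hV
    have hVm : MeasurableSet V :=
      measurableSet_lt measurable_const (measurable_uniformDeviation hfm)
    have hVle : (Measure.pi fun _ => P) V ≤ ENNReal.ofReal δ := by
      rw [← ENNReal.ofReal_toReal (measure_ne_top (Measure.pi fun _ => P) V)]
      exact ENNReal.ofReal_le_ofReal <| (measureReal_uniformDeviation_le hfm hf01 hm
        (Real.sqrt_nonneg _) (empRademacher_comp_le huH hg01 hm)).trans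
          (exp_neg_two_mul_sq_le hδ hδ1 hm)
    have hemb : Measurable fun (S : Fin n → Ex X A) k => S (e k) := by fun_prop
    have hsub : B I ⊆ {S | hits S E = I} ∩ (fun S k => S (e k)) ⁻¹' V := by
      rintro S ⟨hS, -, i, hi⟩
      refine ⟨hS, ?_⟩
      have hle := le_uniformDeviation (P := P) hfm hf01 (fun k => S (e k)) i
      subst hS
      rw [empMoment_eq_average rfl] at hi
      have hrad : radius H δ (hits S E).card = 2 * C + t := by
        rw [radius, hC, ht]
        ring
      rw [hrad] at hi
      exact hi.trans_le hle
    have hlaw := map_cond_pi D hE hDE e (by rw [← hAeq]; exact h0)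
    rw [← hAeq] at hlaw
    calc π (B I) ≤ π ({S | hits S E = I} ∩ (fun S k => S (e k)) ⁻¹' V) := measure_mono hsub
      _ = ProbabilityTheory.cond π {S | hits S E = I} ((fun S k => S (e k)) ⁻¹' V)
            * π {S | hits S E = I} := (ProbabilityTheory.cond_mul_eq_inter (hAm I) _ _).symm
      _ = (Measure.pi fun _ => P) V * π {S | hits S E = I} := by
          rw [← hlaw, Measure.map_apply hemb hVm]
      _ ≤ _ := by gcongr
  calc π {S | 0 < (hits S E).card ∧ ∃ i,
        radius H δ (hits S E).card < |empMoment S g E (u i) - moment D g E (u i)|}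
      ≤ π (⋃ I, B I) := measure_mono fun S hS => Set.mem_iUnion.2 ⟨hits S E, rfl, hS⟩
    _ ≤ ∑ I, π (B I) := measure_iUnion_fintype_le π B
    _ ≤ ∑ I, ENNReal.ofReal δ * π {S | hits S E = I} := Finset.sum_le_sum fun I _ => hBI I
    _ = ENNReal.ofReal δ * ∑ I, π {S | hits S E = I} := by rw [Finset.mul_sum]
    _ ≤ ENNReal.ofReal δ * 1 := by
        gcongr
        rw [← measure_univ (μ := π)]
        refine sum_measure_le_measure_univ (fun I _ => (hAm I).nullMeasurableSet) ?_
        intro I _ I' _ hne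
        refine Disjoint.aedisjoint (Set.disjoint_left.2 fun S hS hS' => hne ?_)
        exact (show hits S E = I from hS).symm.trans hS'
    _ = _ := mul_one _

/-- A bound on the deviations over the countable subfamily holds over the whole family. -/
theorem abs_empMoment_sub_moment_le_of_tendsto {D : Measure (Ex X A)} {h : X → Bool}
    {u : ℕ → X → Bool} (hu : ∀ m, Measurable (u m))
    (hlim : ∀ x, ∀ᶠ m in Filter.atTop, u m x = h x) {g : X × A × Bool × Bool → ℝ}
    (hg : Measurable g) (hg01 : ∀ w, g w ∈ Set.Icc (0 : ℝ) 1) {E : Set (Ex X A)}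
    {S : Fin n → Ex X A} {r : ℝ} (hr : ∀ m, |empMoment S g E (u m) - moment D g E (u m)| ≤ r) :
    |empMoment S g E h - moment D g E h| ≤ r := by
  have hpt : ∀ z : Ex X A, Filter.Tendsto (fun m => g (z.1, z.2.1, z.2.2, u m z.1)) Filter.atTop
      (nhds (g (z.1, z.2.1, z.2.2, h z.1))) := fun z =>
    tendsto_const_nhds.congr' ((hlim z.1).mono fun m hm => by simp only [hm])
  have h1 : Filter.Tendsto (fun m => empMoment S g E (u m)) Filter.atTop
      (nhds (empMoment S g E h)) :=
    (tendsto_finsetSum _ fun i _ => hpt (S i)).div_const _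
  have h2 : Filter.Tendsto (fun m => moment D g E (u m)) Filter.atTop (nhds (moment D g E h)) :=
    tendsto_integral_of_dominated_convergence (fun _ => 1)
      (fun m => (measurable_comp_classifier hg (hu m)).aestronglyMeasurable)
      (integrable_const _)
      (fun m => ae_of_all _ fun z => by
        rw [Real.norm_eq_abs, abs_of_nonneg (hg01 _).1]
        exact (hg01 _).2)
      (ae_of_all _ hpt)
  exact le_of_tendsto (h1.sub h2).abs (Filter.Eventually.of_forall hr)

/-- Uniform convergence of the empirical conditional moments over a pointwise separable family. -/
theorem measure_exists_radius_lt_le_of_pointwiseSeparable (D : Measure (Ex X A))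
    [IsProbabilityMeasure D] {H : Set (X → Bool)} (hHm : ∀ h ∈ H, Measurable h)
    (hHs : PointwiseSeparable H) {g : X × A × Bool × Bool → ℝ} (hg : Measurable g)
    (hg01 : ∀ w, g w ∈ Set.Icc (0 : ℝ) 1) {E : Set (Ex X A)} (hE : MeasurableSet E) {δ : ℝ}
    (hδ : 0 < δ) (hδ1 : δ ≤ 1) :
    (Measure.pi fun _ : Fin n => D) {S | 0 < (hits S E).card ∧ ∃ h ∈ H,
        radius H δ (hits S E).card < |empMoment S g E h - moment D g E h|}
      ≤ ENNReal.ofReal δ := by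
  obtain ⟨H₀, hsub, hcount, hdense⟩ := hHs
  rcases H.eq_empty_or_nonempty with rfl | ⟨h, hh⟩
  · simp
  have : Nonempty H₀ := by
    obtain ⟨u, hu, -⟩ := hdense h hh
    exact ⟨⟨u 0, hu 0⟩⟩
  have : Countable H₀ := hcount
  refine (measure_mono ?_).trans (measure_exists_radius_lt_le (n := n) D
    (u := fun i : H₀ => (i : X → Bool)) (fun i => hsub i.2) (fun i => hHm _ (hsub i.2)) hg hg01 hE
    hδ hδ1)
  rintro S ⟨hpos, h, hh, hlt⟩
  refine ⟨hpos, ?_⟩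
  by_contra! hall
  obtain ⟨u, hu, hlim⟩ := hdense h hh
  exact hlt.not_ge (abs_empMoment_sub_moment_le_of_tendsto (fun m => hHm _ (hsub (hu m))) hlim hg
    hg01 fun m => hall ⟨u m, hu m⟩)

end ConditionalSample

section Mixtures

variable {X : Type*} {H : Set (X → Bool)}

theorem summable_toReal_pmf (Q : PMF H) : Summable fun h => (Q h).toReal :=
  ENNReal.summable_toReal Q.tsum_coe_ne_top

theorem tsum_toReal_pmf (Q : PMF H) : ∑' h, (Q h).toReal = 1 := by
  rw [← ENNReal.tsum_toReal_eq fun h => Q.apply_ne_top h, Q.tsum_coe, ENNReal.toReal_one]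

theorem summable_mix (Q : PMF H) {φ : (X → Bool) → ℝ} {b : ℝ} (hφ : ∀ h ∈ H, |φ h| ≤ b) :
    Summable fun h : H => (Q h).toReal * φ h := by
  refine Summable.of_norm_bounded ((summable_toReal_pmf Q).mul_right b) fun h => ?_
  rw [norm_mul, Real.norm_of_nonneg ENNReal.toReal_nonneg]
  exact mul_le_mul_of_nonneg_left (hφ h h.2) ENNReal.toReal_nonneg

theorem mix_le_mix_add (Q : PMF H) {φ ψ : (X → Bool) → ℝ} {b r : ℝ} (hφ : ∀ h ∈ H, |φ h| ≤ b)
    (hψ : ∀ h ∈ H, |ψ h| ≤ b) (hr : ∀ h ∈ H, φ h - ψ h ≤ r) : mix φ Q ≤ mix ψ Q + r := by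
  have hconst : Summable fun h => (Q h).toReal * r := (summable_toReal_pmf Q).mul_right r
  calc mix φ Q ≤ ∑' h : H, ((Q h).toReal * ψ h + (Q h).toReal * r) :=
        (summable_mix Q hφ).tsum_le_tsum (fun h => by
          rw [← mul_add]
          exact mul_le_mul_of_nonneg_left (by linarith [hr h h.2]) ENNReal.toReal_nonneg)
          ((summable_mix Q hψ).add hconst)
    _ = mix ψ Q + r := by
        rw [(summable_mix Q hψ).tsum_add hconst, tsum_mul_right, tsum_toReal_pmf, one_mul]
        rfl

theorem abs_mix_sub_mix_le (Q : PMF H) {φ ψ : (X → Bool) → ℝ} {b r : ℝ}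
    (hφ : ∀ h ∈ H, |φ h| ≤ b) (hψ : ∀ h ∈ H, |ψ h| ≤ b) (hr : ∀ h ∈ H, |φ h - ψ h| ≤ r) :
    |mix φ Q - mix ψ Q| ≤ r := by
  rw [abs_sub_le_iff]
  constructor
  · linarith [mix_le_mix_add Q hφ hψ fun h hh => (abs_le.1 (hr h hh)).2]
  · linarith [mix_le_mix_add Q hψ hφ (r := r) fun h hh => by linarith [(abs_le.1 (hr h hh)).1]]

theorem mix_mem_Icc (Q : PMF H) {φ : (X → Bool) → ℝ} (hφ : ∀ h ∈ H, φ h ∈ Set.Icc (0 : ℝ) 1) :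
    mix φ Q ∈ Set.Icc (0 : ℝ) 1 := by
  refine ⟨tsum_nonneg fun h => mul_nonneg ENNReal.toReal_nonneg (hφ h h.2).1, ?_⟩
  have h := mix_le_mix_add Q (φ := φ) (ψ := fun _ => 0) (b := 1) (r := 1)
    (fun h hh => by rw [abs_of_nonneg (hφ h hh).1]; exact (hφ h hh).2) (fun h _ => by simp)
    (fun h hh => by simpa using (hφ h hh).2)
  simpa [mix] using h

end Mixtures

section Moments

variable {X A : Type*} {n : ℕ} {g : X × A × Bool × Bool → ℝ}

theorem empMoment_mem_Icc (hg01 : ∀ w, g w ∈ Set.Icc (0 : ℝ) 1) (S : Fin n → Ex X A)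
    (E : Set (Ex X A)) (h : X → Bool) : empMoment S g E h ∈ Set.Icc (0 : ℝ) 1 := by
  rw [empMoment_eq_average rfl]
  exact average_mem_Icc fun k => hg01 _

/-- The misclassification loss, as a function of `(x, a, y, h x)`. -/
def errorLoss (w : X × A × Bool × Bool) : ℝ :=
  if w.2.2.2 ≠ w.2.2.1 then 1 else 0

theorem errorLoss_mem_Icc (w : X × A × Bool × Bool) : errorLoss w ∈ Set.Icc (0 : ℝ) 1 := by
  unfold errorLoss
  split_ifs <;> simp

theorem hits_univ (S : Fin n → Ex X A) : hits S Set.univ = Finset.univ := by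
  simp [hits]

theorem empErr_eq_empMoment (S : Fin n → Ex X A) (h : X → Bool) :
    empErr S h = empMoment S errorLoss Set.univ h := by
  simp [empErr, empMoment, hits_univ, errorLoss]

variable [MeasurableSpace X] [MeasurableSpace A]

theorem abs_moment_le_one (hg01 : ∀ w, g w ∈ Set.Icc (0 : ℝ) 1) (D : Measure (Ex X A))
    (E : Set (Ex X A)) (h : X → Bool) : |moment D g E h| ≤ 1 := by
  refine (norm_integral_le_of_norm_le_const (μ := ProbabilityTheory.cond D E) (C := 1)
    (f := fun z : Ex X A => g (z.1, z.2.1, z.2.2, h z.1)) (ae_of_all _ fun z => ?_)).trans ?_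
  · rw [Real.norm_eq_abs, abs_of_nonneg (hg01 _).1]
    exact (hg01 _).2
  · rw [one_mul]
    exact measureReal_le_one

theorem measurable_errorLoss : Measurable (errorLoss : X × A × Bool × Bool → ℝ) :=
  (Measurable.of_discrete (f := fun p : Bool × Bool => if p.2 ≠ p.1 then (1 : ℝ) else 0)).comp
    (measurable_snd.comp measurable_snd)

theorem err_eq_moment (D : Measure (Ex X A)) [IsProbabilityMeasure D] {h : X → Bool}
    (hh : Measurable h) : err D h = moment D errorLoss Set.univ h := by
  have hs : MeasurableSet {z : Ex X A | h z.1 ≠ z.2.2} :=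
    (measurableSet_eq_fun (hh.comp measurable_fst)
      (measurable_snd.comp measurable_snd)).compl
  rw [moment, ProbabilityTheory.cond_univ, err, ← integral_indicator_one hs]
  refine integral_congr_ae (ae_of_all _ fun z => ?_)
  simp [errorLoss, Set.indicator_apply]

end Moments

section Constraints

variable {X A J K : Type*} {n : ℕ} [Fintype J] {H : Set (X → Bool)}
  {S : Fin n → Ex X A} {g : J → X × A × Bool × Bool → ℝ} {E : J → Set (Ex X A)} {M : Matrix K J ℝ}
  [MeasurableSpace X] [MeasurableSpace A] {D : Measure (Ex X A)} {δ : ℝ} {ε : K → ℝ}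

theorem abs_empConstr_sub_constr_le (hg01 : ∀ j w, g j w ∈ Set.Icc (0 : ℝ) 1)
    (hdev : ∀ j, 0 < (hits S (E j)).card → ∀ h ∈ H,
      |empMoment S (g j) (E j) h - moment D (g j) (E j) h| ≤ radius H δ (hits S (E j)).card)
    (hε : IsSlack S H E M δ ε) (Q : PMF H) (k : K) :
    |empConstr S g E M Q k - constr D g E M Q k| ≤ ε k := by
  refine le_trans ?_ (hε k).2
  rw [empConstr, constr, ← Finset.sum_sub_distrib]
  refine (Finset.abs_sum_le_sum_abs _ _).trans (Finset.sum_le_sum fun j _ => ?_)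
  rw [← mul_sub, abs_mul]
  rcases eq_or_ne (M k j) 0 with h0 | h0
  · simp [h0]
  · refine mul_le_mul_of_nonneg_left ?_ (abs_nonneg _)
    refine abs_mix_sub_mix_le Q (b := 1) (fun h _ => ?_)
      (fun h _ => abs_moment_le_one (hg01 j) _ _ _) (hdev j ((hε k).1 j h0))
    have := empMoment_mem_Icc (hg01 j) S (E j) h
    rw [abs_of_nonneg this.1]
    exact this.2

end Constraints

section ApproximateSaddlePoints

variable {X A J K : Type*} {n : ℕ} [Fintype J] {H : Set (X → Bool)}
  {S : Fin n → Ex X A} {g : J → X × A × Bool × Bool → ℝ} {E : J → Set (Ex X A)} {M : Matrix K J ℝ}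
  [Fintype K] {c' : K → ℝ} {B ν : ℝ} {Q Q' : PMF H} {l : K → ℝ}

theorem empErr_mix_mem_Icc (S : Fin n → Ex X A) (Q : PMF H) :
    mix (empErr S) Q ∈ Set.Icc (0 : ℝ) 1 :=
  mix_mem_Icc Q fun h _ => by
    rw [empErr_eq_empMoment]
    exact empMoment_mem_Icc errorLoss_mem_Icc _ _ _

/-- The Lagrangian of an approximate saddle point is at most the empirical error of a feasible
randomized classifier, up to `ν`. -/
theorem IsApproxSaddle.lagrangian_le (hs : IsApproxSaddle S g E M c' B ν Q l)
    (hQ' : ∀ k, empConstr S g E M Q' k ≤ c' k) :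
    lagrangian S g E M c' Q l ≤ mix (empErr S) Q' + ν := by
  have hneg : ∑ k, l k * (empConstr S g E M Q' k - c' k) ≤ 0 :=
    Finset.sum_nonpos fun k _ => mul_nonpos_of_nonneg_of_nonpos (hs.1.1 k) (by linarith [hQ' k])
  have := hs.2.1 Q'
  rw [lagrangian.eq_1 S g E M c' Q'] at this
  linarith

theorem IsApproxSaddle.empErr_le (hs : IsApproxSaddle S g E M c' B ν Q l) (hB : 0 ≤ B)
    (hQ' : ∀ k, empConstr S g E M Q' k ≤ c' k) :
    mix (empErr S) Q ≤ mix (empErr S) Q' + 2 * ν := by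
  have h0 := hs.2.2 0 ⟨fun _ => le_rfl, by simpa using hB⟩
  have hL : lagrangian S g E M c' Q 0 = mix (empErr S) Q := by simp [lagrangian]
  linarith [hs.lagrangian_le hQ']

theorem IsApproxSaddle.empConstr_le (hs : IsApproxSaddle S g E M c' B ν Q l) (hB : 0 < B)
    (hQ' : ∀ k, empConstr S g E M Q' k ≤ c' k) (k : K) :
    empConstr S g E M Q k ≤ c' k + (1 + 2 * ν) / B := by
  classical
  have hdom : (Pi.single k B : K → ℝ) ∈ dualDomain K B := by
    refine ⟨fun k' => ?_, le_of_eq ?_⟩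
    · rcases eq_or_ne k' k with rfl | hk
      · simpa using hB.le
      · simp [hk]
    · rw [Finset.sum_eq_single k (fun k' _ hk => by simp [hk]) (by simp)]
      simp [abs_of_pos hB]
  have hk := hs.2.2 _ hdom
  have hL : lagrangian S g E M c' Q (Pi.single k B)
      = mix (empErr S) Q + B * (empConstr S g E M Q k - c' k) := by
    rw [lagrangian, Finset.sum_eq_single k (fun k' _ hk => by simp [hk]) (by simp)]
    simp
  have h1 := hs.lagrangian_le hQ'
  have h2 : B * (empConstr S g E M Q k - c' k) ≤ 1 + 2 * ν := by
    linarith [(empErr_mix_mem_Icc S Q).1, (empErr_mix_mem_Icc S Q').2]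
  have h3 : empConstr S g E M Q k - c' k ≤ (1 + 2 * ν) / B := by
    rw [le_div_iff₀ hB]
    linarith
  linarith

end ApproximateSaddlePoints

theorem two_mul_radius {X : Type*} (H : Set (X → Bool)) (δ : ℝ) (n : ℕ) :
    2 * radius H δ n = 4 * rademacher (realClass H) n + 4 / √(n : ℝ)
      + √(2 * Real.log (2 / δ) / (n : ℝ)) := by
  have h : √(2 * Real.log (2 / δ) / (n : ℝ)) = 2 * √(Real.log (2 / δ) / (2 * (n : ℝ))) := by
    rw [show 2 * Real.log (2 / δ) / (n : ℝ) = 2 ^ 2 * (Real.log (2 / δ) / (2 * (n : ℝ))) by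
      rw [mul_div_assoc', mul_div_mul_comm]
      ring, Real.sqrt_mul (by norm_num), Real.sqrt_sq (by norm_num)]
  rw [h, radius]
  ring

end FairClassification

open FairClassification
theorem theorem4 {X A J K : Type*} [MeasurableSpace X] [MeasurableSpace A] [Fintype J] [Fintype K]
    (D : Measure (X × A × Bool)) [IsProbabilityMeasure D]
    (H : Set (X → Bool)) (hHm : ∀ h ∈ H, Measurable h) (hHs : PointwiseSeparable H)
    (g : J → X × A × Bool × Bool → ℝ) (hg : ∀ j, Measurable (g j))
    (hg01 : ∀ j w, g j w ∈ Set.Icc (0 : ℝ) 1)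
    (E : J → Set (X × A × Bool)) (hE : ∀ j, MeasurableSet (E j))
    (M : Matrix K J ℝ) (c : K → ℝ) (B ν δ : ℝ) (hB : 0 < B) (hδ : 0 < δ)
    (n : ℕ) (hn : 0 < n)
    (Qstar : PMF H) (hQstar : IsOptimal D g E M c Qstar) :
    ∃ G : Set (Fin n → X × A × Bool), MeasurableSet G ∧
      1 - ((Fintype.card J : ℝ) + 1) * δ ≤ (Measure.pi fun _ : Fin n => D).real G ∧
      ∀ S ∈ G, ∀ ε : K → ℝ, IsSlack S H E M δ ε →
        ∀ (Qhat : PMF H) (lhat : K → ℝ), IsApproxSaddle S g E M (c + ε) B ν Qhat lhat →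
          mix (err D) Qhat ≤ mix (err D) Qstar + 2 * ν
              + 4 * rademacher (realClass H) n + 4 / √(n : ℝ)
              + √(2 * Real.log (2 / δ) / (n : ℝ)) ∧
          ∀ k, constr D g E M Qhat k ≤ c k + (1 + 2 * ν) / B + 2 * ε k := by
  rcases lt_or_ge 1 δ with hδ1 | hδ1
  · refine ⟨∅, MeasurableSet.empty, ?_, fun S hS => hS.elim⟩
    have : (0 : ℝ) ≤ Fintype.card J := by positivity
    rw [measureReal_empty]
    nlinarith
  set π : Measure (Fin n → X × A × Bool) := Measure.pi fun _ => D with hπ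
  set bad : (X × A × Bool × Bool → ℝ) → Set (X × A × Bool) → Set (Fin n → X × A × Bool) :=
    fun g E => {S | 0 < (hits S E).card ∧ ∃ h ∈ H,
      radius H δ (hits S E).card < |empMoment S g E h - moment D g E h|} with hbad
  set T : Set (Fin n → X × A × Bool) := bad errorLoss Set.univ ∪ ⋃ j, bad (g j) (E j) with hT
  have hTle : π T ≤ ENNReal.ofReal (((Fintype.card J : ℝ) + 1) * δ) := by
    calc π T ≤ π (bad errorLoss Set.univ) + ∑ j, π (bad (g j) (E j)) :=
          (measure_union_le _ _).trans (add_le_add le_rfl (measure_iUnion_fintype_le _ _))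
      _ ≤ ENNReal.ofReal δ + ∑ _j : J, ENNReal.ofReal δ := by
          gcongr with j
          · exact measure_exists_radius_lt_le_of_pointwiseSeparable D hHm hHs measurable_errorLoss
              errorLoss_mem_Icc MeasurableSet.univ hδ hδ1
          · exact measure_exists_radius_lt_le_of_pointwiseSeparable D hHm hHs (hg j) (hg01 j) (hE j)
              hδ hδ1
      _ = ENNReal.ofReal (((Fintype.card J : ℝ) + 1) * δ) := by
          rw [ENNReal.ofReal_mul (by positivity), ENNReal.ofReal_add (by positivity) zero_le_one,
            ENNReal.ofReal_natCast, ENNReal.ofReal_one, Finset.sum_const, Finset.card_univ,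
            nsmul_eq_mul]
          ring
  refine ⟨(toMeasurable π T)ᶜ, (measurableSet_toMeasurable _ _).compl, ?_, ?_⟩
  · rw [probReal_compl_eq_one_sub (measurableSet_toMeasurable _ _), measureReal_def,
      measure_toMeasurable]
    have := ENNReal.toReal_le_of_le_ofReal (by positivity) hTle
    linarith
  intro S hS ε hε Qhat lhat hsaddle
  have hST : S ∉ T := fun h => hS (subset_toMeasurable _ _ h)
  simp only [hT, Set.mem_union, Set.mem_iUnion, not_or, not_exists] at hST
  have hdev : ∀ j, 0 < (hits S (E j)).card → ∀ h ∈ H,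
      |empMoment S (g j) (E j) h - moment D (g j) (E j) h|
        ≤ radius H δ (hits S (E j)).card := fun j hpos h hh =>
    not_lt.1 fun hlt => hST.2 j ⟨hpos, h, hh, hlt⟩
  have herr : ∀ h ∈ H, |empErr S h - err D h| ≤ radius H δ n := fun h hh => by
    rw [empErr_eq_empMoment, err_eq_moment D (hHm h hh)]
    refine not_lt.1 fun hlt => hST.1 ⟨by simpa [hits_univ] using hn, h, hh, ?_⟩
    simpa [hits_univ] using hlt
  have herrmix : ∀ Q : PMF H, |mix (empErr S) Q - mix (err D) Q| ≤ radius H δ n := fun Q =>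
    abs_mix_sub_mix_le Q (b := 1)
      (fun h _ => by
        rw [empErr_eq_empMoment]
        have := empMoment_mem_Icc errorLoss_mem_Icc S Set.univ h
        rw [abs_of_nonneg this.1]
        exact this.2)
      (fun h hh => by
        rw [err_eq_moment D (hHm h hh)]
        exact abs_moment_le_one errorLoss_mem_Icc _ _ _) herr
  have hconstr := abs_empConstr_sub_constr_le hg01 hdev hε
  have hfeas : ∀ k, empConstr S g E M Qstar k ≤ (c + ε) k := fun k => by
    have h1 := (abs_le.1 (hconstr Qstar k)).2
    have h2 := hQstar.1 k
    simp only [Pi.add_apply]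
    linarith
  refine ⟨?_, fun k => ?_⟩
  · have h1 := hsaddle.empErr_le hB.le hfeas
    have h2 := (abs_le.1 (herrmix Qhat)).1
    have h3 := (abs_le.1 (herrmix Qstar)).2
    linarith [two_mul_radius H δ n]
  · have h1 := hsaddle.empConstr_le hB hfeas k
    have h2 := (abs_le.1 (hconstr Qhat k)).1
    simp only [Pi.add_apply] at h1
    linarith
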